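/- Let $\Bbbk$ be a field and let $A$ be a finite-dimensional Hopf algebra over $\Bbbk$ with comultiplication $\Delta$, counit $\varepsilon$ and antipode $S$. Let $J=J^{(1)}\otimes J^{(2)}\in A\otimes A$ be a normalized twist, i.e. an invertible element with $(\varepsilon\otimes\mathrm{id})(J)=(\mathrm{id}\otimes\varepsilon)(J)=1$ and $$(\Delta\otimes\mathrm{id})(J)(J\otimes 1)=(\mathrm{id}\otimes\Delta)(J)(1\otimes J),$$ and write $J^{-1}=J^{-(1)}\otimes J^{-(2)}$ (summations understood). Let $Q_J=S(J^{(1)})J^{(2)}$, which is invertible with inverse $J^{-(1)}S(J^{-(2)})$, and let $A^J$ be the twisted Hopf algebra: it has the algebra structure and the counit of $A$, the comultiplication $\Delta^J(a)=J^{-1}\Delta(a)J$ and the antipode $S^J(a)=Q_J^{-1}S(a)Q_J$. For a Hopf algebra $H$, a right integral in $H^*$ is a functional $f\in H^*$ with $f*g=g(1)f$ for all $g\in H^*$, where $*$ is the convolution product. For $f\in A^*$ and $a\in A$ let $f\leftharpoonup a\in A^*$ be given by $(f\leftharpoonup a)(b)=f(ab)$. Let $\lambda$ be a nonzero right integral in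 $A^*$. Then there is exactly one algebra map $\alpha:A\to\Bbbk$ (the distinguished group-like element of $A^*$) such that $\Lambda a=\alpha(a)\Lambda$ for all $a\in A$, for some nonzero left integral $\Lambda$ of $A$ (that is, $a\Lambda=\varepsilon(a)\Lambda$ for all $a\in A$). The element $R=\alpha(J^{-(1)})J^{-(2)}$ is invertible in $A$, and $$\lambda^J:=\lambda\leftharpoonup S^2(R^{-1})\,S(Q_J^{-1})\,Q_J$$ is a nonzero right integral in $(A^J)^*$. -/

import Mathlib

open scoped TensorProduct

noncomputable section

namespace HopfTwist

open Coalgebra Bialgebra HopfAlgebra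

section Integrals

variable (k : Type*) {A : Type*} [Field k] [Ring A]

/-- `Λ ∈ A` is a left integral: `a Λ = ε(a) Λ` for all `a ∈ A`. -/
def IsLeftIntegral [Bialgebra k A] (Λ : A) : Prop :=
  ∀ a : A, a * Λ = counit (R := k) a • Λ

variable {k}

/-- `f ∈ A^*` is a right integral in the dual algebra `A^*`, whose product is the convolution
product and whose augmentation is evaluation at `1`: one has `f g = g(1) f` for all `g ∈ A^*`. -/
def IsRightIntegralInDual [Bialgebra k A] (f : Module.Dual k A) : Prop :=
  ∀ g : Module.Dual k A,
    WithConv.toConv f * WithConv.toConv g = WithConv.toConv (g 1 • f)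

/-- `α` is the distinguished group-like element of `A^*`: for a nonzero left integral `Λ` of `A`
one has `Λ a = α(a) Λ` for all `a ∈ A`. Group-like elements of `A^*` are algebra maps `A → k`. -/
def IsDistinguishedGroupLike [Bialgebra k A] (α : A →ₐ[k] k) : Prop :=
  ∃ Λ : A, IsLeftIntegral k Λ ∧ Λ ≠ 0 ∧ ∀ a : A, Λ * a = α a • Λ

/-- The right action of `A` on `A^*`: `(f ↼ a)(b) = f(a b)`. -/
def rightAct [Algebra k A] (f : Module.Dual k A) (a : A) : Module.Dual k A :=
  f ∘ₗ LinearMap.mulLeft k a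

end Integrals

section Twist

variable {k A : Type*} [Field k] [Ring A]

/-- The algebra map `A ⊗ A → A`, `x ⊗ y ↦ α(x) y`. -/
def applyLeft [Algebra k A] (α : A →ₐ[k] k) : A ⊗[k] A →ₐ[k] A :=
  (Algebra.TensorProduct.lid k A).toAlgHom.comp (Algebra.TensorProduct.map α (AlgHom.id k A))

/-- The algebra map `A ⊗ A → A`, `x ⊗ y ↦ x α(y)`. -/
def applyRight [Algebra k A] (α : A →ₐ[k] k) : A ⊗[k] A →ₐ[k] A :=
  (Algebra.TensorProduct.rid k k A).toAlgHom.comp (Algebra.TensorProduct.map (AlgHom.id k A) α)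

@[simp] theorem applyLeft_tmul [Algebra k A] (α : A →ₐ[k] k) (x y : A) :
    applyLeft α (x ⊗ₜ[k] y) = α x • y := by simp [applyLeft]

@[simp] theorem applyRight_tmul [Algebra k A] (α : A →ₐ[k] k) (x y : A) :
    applyRight α (x ⊗ₜ[k] y) = α y • x := by simp [applyRight]

variable [HopfAlgebra k A]

/-- `(Δ ⊗ id) : A ⊗ A → A ⊗ (A ⊗ A)`, with the target reassociated. -/
def comulLeft : A ⊗[k] A →ₐ[k] A ⊗[k] (A ⊗[k] A) :=
  (Algebra.TensorProduct.assoc k k k A A A).toAlgHom.comp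
    (Algebra.TensorProduct.map (comulAlgHom k A) (AlgHom.id k A))

/-- `(id ⊗ Δ) : A ⊗ A → A ⊗ (A ⊗ A)`. -/
def comulRight : A ⊗[k] A →ₐ[k] A ⊗[k] (A ⊗[k] A) :=
  Algebra.TensorProduct.map (AlgHom.id k A) (comulAlgHom k A)

/-- `X ↦ X ⊗ 1`, as a map `A ⊗ A → A ⊗ (A ⊗ A)`. -/
def tmulOne : A ⊗[k] A →ₐ[k] A ⊗[k] (A ⊗[k] A) :=
  (Algebra.TensorProduct.assoc k k k A A A).toAlgHom.comp
    Algebra.TensorProduct.includeLeft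

/-- `X ↦ 1 ⊗ X`, as a map `A ⊗ A → A ⊗ (A ⊗ A)`. -/
def oneTmul : A ⊗[k] A →ₐ[k] A ⊗[k] (A ⊗[k] A) :=
  Algebra.TensorProduct.includeRight

/-- The linear map `x ⊗ y ↦ S(x) y`. -/
def antipodeMul : A ⊗[k] A →ₗ[k] A :=
  LinearMap.mul' k A ∘ₗ (antipode k).rTensor A

/-- The linear map `x ⊗ y ↦ x S(y)`. -/
def mulAntipode : A ⊗[k] A →ₗ[k] A :=
  LinearMap.mul' k A ∘ₗ (antipode k).lTensor A

variable (k A) in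
/-- A normalized twist: an invertible `J ∈ A ⊗ A` with `(ε ⊗ id)(J) = (id ⊗ ε)(J) = 1` and
`(Δ ⊗ id)(J)(J ⊗ 1) = (id ⊗ Δ)(J)(1 ⊗ J)`. -/
structure NormalizedTwist where
  J : (A ⊗[k] A)ˣ
  counit_left : applyLeft (counitAlgHom k A) (J : A ⊗[k] A) = 1
  counit_right : applyRight (counitAlgHom k A) (J : A ⊗[k] A) = 1
  cocycle : comulLeft (J : A ⊗[k] A) * tmulOne (J : A ⊗[k] A) =
    comulRight (J : A ⊗[k] A) * oneTmul (J : A ⊗[k] A)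

@[simp] theorem antipodeMul_tmul (x y : A) :
    antipodeMul (k := k) (x ⊗ₜ[k] y) = antipode k x * y := by simp [antipodeMul]

@[simp] theorem mulAntipode_tmul (x y : A) :
    mulAntipode (k := k) (x ⊗ₜ[k] y) = x * antipode k y := by simp [mulAntipode]

@[simp] theorem tmulOne_tmul (x y : A) :
    tmulOne (x ⊗ₜ[k] y) = x ⊗ₜ[k] (y ⊗ₜ[k] (1 : A)) := by simp [tmulOne]

@[simp] theorem oneTmul_apply (X : A ⊗[k] A) :
    oneTmul X = (1 : A) ⊗ₜ[k] X := by simp [oneTmul]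

theorem antipodeMul_comul (a : A) :
    antipodeMul (comul (R := k) a) = counit (R := k) a • (1 : A) := by
  simp [antipodeMul, Algebra.algebraMap_eq_smul_one]

theorem mulAntipode_comul (a : A) :
    mulAntipode (comul (R := k) a) = counit (R := k) a • (1 : A) := by
  simp [mulAntipode, Algebra.algebraMap_eq_smul_one]

/-- `x ⊗ y ⊗ z ↦ S(x) y S(z)`. -/
def sandwich₁ : A ⊗[k] (A ⊗[k] A) →ₗ[k] A :=
  LinearMap.mul' k A ∘ₗ TensorProduct.map (antipode k) mulAntipode

/-- `x ⊗ y ⊗ z ↦ x S(y) z`. -/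
def sandwich₂ : A ⊗[k] (A ⊗[k] A) →ₗ[k] A :=
  LinearMap.mul' k A ∘ₗ TensorProduct.map LinearMap.id antipodeMul

theorem sandwich₁_tmulOne_mul_oneTmul (X Y : A ⊗[k] A) :
    sandwich₁ (tmulOne X * oneTmul Y) = antipodeMul X * mulAntipode Y := by
  induction X with
  | zero => simp
  | add X X' hX hX' => simp only [map_add, add_mul, hX, hX']
  | tmul x y =>
    induction Y with
    | zero => simp
    | add Y Y' hY hY' => simp only [map_add, mul_add, hY, hY']
    | tmul z w => simp [sandwich₁, mul_assoc]

theorem sandwich₂_oneTmul_mul_tmulOne (X Y : A ⊗[k] A) :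
    sandwich₂ (oneTmul Y * tmulOne X) = mulAntipode X * antipodeMul Y := by
  induction X with
  | zero => simp
  | add X X' hX hX' => simp only [map_add, add_mul, mul_add, hX, hX']
  | tmul x y =>
    induction Y with
    | zero => simp
    | add Y Y' hY hY' => simp only [map_add, add_mul, mul_add, hY, hY']
    | tmul z w => simp [sandwich₂, antipode_mul_antidistrib, mul_assoc]

theorem sandwich₁_aux (y z : A) (X Y : A ⊗[k] A) :
    sandwich₁ (Algebra.TensorProduct.assoc k k k A A A (X ⊗ₜ[k] y) * (z ⊗ₜ[k] Y)) =
      antipode k z * antipodeMul X * mulAntipode Y * antipode k y := by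
  induction X with
  | zero => simp
  | add X X' hX hX' => simp only [map_add, TensorProduct.add_tmul, add_mul, mul_add, hX, hX']
  | tmul x₁ x₂ =>
    induction Y with
    | zero => simp
    | add Y Y' hY hY' => simp only [map_add, TensorProduct.tmul_add, add_mul, mul_add, hY, hY']
    | tmul z w => simp [sandwich₁, antipode_mul_antidistrib, mul_assoc]

theorem sandwich₂_aux (y z : A) (X Y : A ⊗[k] A) :
    sandwich₂ ((z ⊗ₜ[k] Y) * Algebra.TensorProduct.assoc k k k A A A (X ⊗ₜ[k] y)) =
      z * mulAntipode X * antipodeMul Y * y := by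
  induction X with
  | zero => simp
  | add X X' hX hX' => simp only [map_add, TensorProduct.add_tmul, add_mul, mul_add, hX, hX']
  | tmul x₁ x₂ =>
    induction Y with
    | zero => simp
    | add Y Y' hY hY' => simp only [map_add, TensorProduct.tmul_add, add_mul, mul_add, hY, hY']
    | tmul z w => simp [sandwich₂, antipode_mul_antidistrib, mul_assoc]

theorem sandwich₁_comulLeft_mul_comulRight (X Y : A ⊗[k] A) :
    sandwich₁ (comulLeft X * comulRight Y) =
      antipode k (applyRight (counitAlgHom k A) Y) *
        antipode k (applyLeft (counitAlgHom k A) X) := by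
  induction X with
  | zero => simp
  | add X X' hX hX' => simp only [map_add, add_mul, mul_add, hX, hX']
  | tmul x y =>
    induction Y with
    | zero => simp
    | add Y Y' hY hY' => simp only [map_add, add_mul, mul_add, hY, hY']
    | tmul z w =>
      have h := sandwich₁_aux (k := k) y z (comul x) (comul w)
      rw [antipodeMul_comul, mulAntipode_comul] at h
      simpa [comulLeft, comulRight, smul_smul, mul_comm] using h

theorem sandwich₂_comulRight_mul_comulLeft (X Y : A ⊗[k] A) :
    sandwich₂ (comulRight Y * comulLeft X) =
      applyRight (counitAlgHom k A) Y * applyLeft (counitAlgHom k A) X := by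
  induction X with
  | zero => simp
  | add X X' hX hX' => simp only [map_add, mul_add, hX, hX']
  | tmul x y =>
    induction Y with
    | zero => simp
    | add Y Y' hY hY' => simp only [map_add, add_mul, hY, hY']
    | tmul z w =>
      have h := sandwich₂_aux (k := k) y z (comul x) (comul w)
      rw [antipodeMul_comul, mulAntipode_comul] at h
      simpa [comulLeft, comulRight, smul_smul, mul_comm] using h

theorem antipodeMul_mul (X Y : A ⊗[k] A) (c : A) (h : antipodeMul X = c) :
    antipodeMul (X * Y) = LinearMap.mul' k A
      (TensorProduct.map (antipode k) (LinearMap.mulLeft k c) Y) := by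
  subst h
  induction Y with
  | zero => simp
  | add Y Y' hY hY' => simp only [map_add, mul_add, hY, hY']
  | tmul z w =>
    induction X with
    | zero => simp
    | add X X' hX hX' =>
      simp only [map_add, add_mul, hX, hX', TensorProduct.map_tmul, LinearMap.mul'_apply,
        LinearMap.mulLeft_apply, mul_add]
    | tmul x y => simp [antipode_mul_antidistrib, mul_assoc]

theorem mulAntipode_mul (X Y : A ⊗[k] A) (c : A) (h : mulAntipode Y = c) :
    mulAntipode (X * Y) = LinearMap.mul' k A
      (TensorProduct.map (LinearMap.mulRight k c) (antipode k) X) := by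
  subst h
  induction X with
  | zero => simp
  | add X X' hX hX' => simp only [map_add, add_mul, hX, hX']
  | tmul z w =>
    induction Y with
    | zero => simp
    | add Y Y' hY hY' =>
      simp only [map_add, mul_add, add_mul, hY, hY', TensorProduct.map_tmul, LinearMap.mul'_apply,
        LinearMap.mulRight_apply]
    | tmul x y => simp [antipode_mul_antidistrib, mul_assoc]

namespace NormalizedTwist

variable (J : NormalizedTwist k A)

theorem counit_left_inv : applyLeft (counitAlgHom k A) (↑J.J⁻¹ : A ⊗[k] A) = 1 := by
  have h := congrArg (applyLeft (counitAlgHom k A)) J.J.inv_mul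
  rwa [map_mul, map_one, J.counit_left, mul_one] at h

theorem counit_right_inv : applyRight (counitAlgHom k A) (↑J.J⁻¹ : A ⊗[k] A) = 1 := by
  have h := congrArg (applyRight (counitAlgHom k A)) J.J.inv_mul
  rwa [map_mul, map_one, J.counit_right, mul_one] at h

theorem map_inv_mul {B : Type*} [Ring B] [Algebra k B] (f : A ⊗[k] A →ₐ[k] B) :
    f (↑J.J⁻¹) * f (↑J.J) = 1 := by rw [← map_mul, Units.inv_mul, map_one]

theorem map_mul_inv {B : Type*} [Ring B] [Algebra k B] (f : A ⊗[k] A →ₐ[k] B) :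
    f (↑J.J) * f (↑J.J⁻¹) = 1 := by rw [← map_mul, Units.mul_inv, map_one]

theorem cocycle₁ : tmulOne (J.J : A ⊗[k] A) * oneTmul (↑J.J⁻¹ : A ⊗[k] A) =
    comulLeft (↑J.J⁻¹ : A ⊗[k] A) * comulRight (J.J : A ⊗[k] A) := by
  calc _ = comulLeft (↑J.J⁻¹) * (comulLeft (↑J.J) * tmulOne (J.J : A ⊗[k] A)) *
        oneTmul (↑J.J⁻¹ : A ⊗[k] A) := by
        rw [← mul_assoc, J.map_inv_mul, one_mul]
    _ = _ := by rw [J.cocycle, mul_assoc, mul_assoc, J.map_mul_inv, mul_one]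

theorem cocycle₂ : oneTmul (J.J : A ⊗[k] A) * tmulOne (↑J.J⁻¹ : A ⊗[k] A) =
    comulRight (↑J.J⁻¹ : A ⊗[k] A) * comulLeft (J.J : A ⊗[k] A) := by
  calc _ = comulRight (↑J.J⁻¹) * (comulRight (↑J.J) * oneTmul (J.J : A ⊗[k] A)) *
        tmulOne (↑J.J⁻¹ : A ⊗[k] A) := by
        rw [← mul_assoc, J.map_inv_mul, one_mul]
    _ = _ := by rw [← J.cocycle, mul_assoc, mul_assoc, J.map_mul_inv, mul_one]

/-- The invertible element `Q_J = S(J^{(1)}) J^{(2)}`, with inverse `J^{-(1)} S(J^{-(2)})`. -/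
def Q : Aˣ where
  val := antipodeMul (J.J : A ⊗[k] A)
  inv := mulAntipode (↑J.J⁻¹ : A ⊗[k] A)
  val_inv := by
    rw [← sandwich₁_tmulOne_mul_oneTmul, J.cocycle₁, sandwich₁_comulLeft_mul_comulRight,
      J.counit_right, J.counit_left_inv]
    simp
  inv_val := by
    rw [← sandwich₂_oneTmul_mul_tmulOne, J.cocycle₂, sandwich₂_comulRight_mul_comulLeft,
      J.counit_left, J.counit_right_inv]
    simp

/-- The invertible element `R = α(J^{-(1)}) J^{-(2)}`, for an algebra map `α : A → k`. -/
def R (α : A →ₐ[k] k) : Aˣ :=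
  Units.map (applyLeft α : A ⊗[k] A →* A) J.J⁻¹

/-- The twisted comultiplication `Δ^J(a) = J⁻¹ Δ(a) J`. -/
def twistedComul : A →ₐ[k] A ⊗[k] A :=
  AlgHom.ofLinearMap
    (LinearMap.mulLeft k (↑J.J⁻¹ : A ⊗[k] A) ∘ₗ LinearMap.mulRight k (J.J : A ⊗[k] A) ∘ₗ comul)
    (by simp)
    (fun a b => by
      simp only [LinearMap.comp_apply, LinearMap.mulLeft_apply, LinearMap.mulRight_apply,
        Bialgebra.comul_mul, mul_assoc, Units.mul_inv_cancel_left])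

theorem twistedComul_apply (a : A) :
    J.twistedComul a = (↑J.J⁻¹ : A ⊗[k] A) * comul (R := k) a * (J.J : A ⊗[k] A) := by
  simp [twistedComul, mul_assoc]

/-- The twisted antipode `S^J(a) = Q_J⁻¹ S(a) Q_J`. -/
def twistedAntipode : A →ₗ[k] A :=
  LinearMap.mulLeft k (↑J.Q⁻¹ : A) ∘ₗ LinearMap.mulRight k (J.Q : A) ∘ₗ antipode k

theorem twistedAntipode_apply (a : A) :
    J.twistedAntipode a = (↑J.Q⁻¹ : A) * antipode k a * (J.Q : A) := by
  simp [twistedAntipode, mul_assoc]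

theorem map_twistedComul_id (X : A ⊗[k] A) :
    Algebra.TensorProduct.assoc k k k A A A
      (Algebra.TensorProduct.map J.twistedComul (AlgHom.id k A) X) =
      tmulOne (↑J.J⁻¹ : A ⊗[k] A) * comulLeft X * tmulOne (J.J : A ⊗[k] A) := by
  induction X with
  | zero => simp
  | add X X' hX hX' => simp only [map_add, mul_add, add_mul, hX, hX']
  | tmul x y =>
    have : (J.twistedComul x) ⊗ₜ[k] y = ((↑J.J⁻¹ : A ⊗[k] A) ⊗ₜ[k] (1 : A)) *
        (comul (R := k) x ⊗ₜ[k] y) * ((J.J : A ⊗[k] A) ⊗ₜ[k] (1 : A)) := by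
      simp [twistedComul_apply]
    rw [Algebra.TensorProduct.map_tmul, AlgHom.id_apply, this, map_mul, map_mul]
    rfl

theorem map_id_twistedComul (X : A ⊗[k] A) :
    Algebra.TensorProduct.map (AlgHom.id k A) J.twistedComul X =
      oneTmul (↑J.J⁻¹ : A ⊗[k] A) * comulRight X * oneTmul (J.J : A ⊗[k] A) := by
  induction X with
  | zero => simp
  | add X X' hX hX' => simp only [map_add, mul_add, add_mul, hX, hX']
  | tmul x y => simp [twistedComul_apply, comulRight]

theorem comulLeft_comul (a : A) :
    comulLeft (comul (R := k) a) = comulRight (comul (R := k) a) :=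
  Coalgebra.coassoc_apply (R := k) a

theorem cocycle_inv : tmulOne (↑J.J⁻¹ : A ⊗[k] A) * comulLeft (↑J.J⁻¹ : A ⊗[k] A) =
    oneTmul (↑J.J⁻¹ : A ⊗[k] A) * comulRight (↑J.J⁻¹ : A ⊗[k] A) := by
  refine left_inv_eq_right_inv (a := comulLeft (J.J : A ⊗[k] A) * tmulOne (J.J : A ⊗[k] A)) ?_ ?_
  · rw [mul_assoc, ← mul_assoc (comulLeft _) (comulLeft _), J.map_inv_mul, one_mul, J.map_inv_mul]
  · rw [J.cocycle, mul_assoc, ← mul_assoc (oneTmul _) (oneTmul _), J.map_mul_inv, one_mul,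
      J.map_mul_inv]

theorem twistedComul_coassoc (a : A) :
    Algebra.TensorProduct.assoc k k k A A A
      (Algebra.TensorProduct.map J.twistedComul (AlgHom.id k A) (J.twistedComul a)) =
    Algebra.TensorProduct.map (AlgHom.id k A) J.twistedComul (J.twistedComul a) := by
  rw [map_twistedComul_id, map_id_twistedComul, twistedComul_apply]
  simp only [map_mul]
  rw [comulLeft_comul]
  calc _ = (tmulOne (↑J.J⁻¹ : A ⊗[k] A) * comulLeft (↑J.J⁻¹ : A ⊗[k] A)) *
          comulRight (comul (R := k) a) *
          (comulLeft (J.J : A ⊗[k] A) * tmulOne (J.J : A ⊗[k] A)) := by simp only [mul_assoc]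
    _ = _ := by rw [J.cocycle_inv, J.cocycle]; simp only [mul_assoc]

theorem applyLeft_comul (a : A) :
    applyLeft (counitAlgHom k A) (comul (R := k) a) = a := by
  have h := Coalgebra.rTensor_counit_comul (R := k) a
  have h' := congrArg (TensorProduct.lid k A) h
  rwa [TensorProduct.lid_tmul, one_smul] at h'

theorem applyRight_comul (a : A) :
    applyRight (counitAlgHom k A) (comul (R := k) a) = a := by
  have h := Coalgebra.lTensor_counit_comul (R := k) a
  have h' := congrArg (TensorProduct.rid k A) h
  rwa [TensorProduct.rid_tmul, one_smul] at h'

theorem rTensor_counit_twistedComul (a : A) :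
    (counit : A →ₗ[k] k).rTensor A (J.twistedComul a) = (1 : k) ⊗ₜ[k] a := by
  refine (TensorProduct.lid k A).injective ?_
  have : applyLeft (counitAlgHom k A) (J.twistedComul a) = a := by
    rw [twistedComul_apply, map_mul, map_mul, J.counit_left, J.counit_left_inv,
      applyLeft_comul, one_mul, mul_one]
  exact this.trans (by simp)

theorem lTensor_counit_twistedComul (a : A) :
    (counit : A →ₗ[k] k).lTensor A (J.twistedComul a) = a ⊗ₜ[k] (1 : k) := by
  refine (TensorProduct.rid k A).injective ?_
  have : applyRight (counitAlgHom k A) (J.twistedComul a) = a := by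
    rw [twistedComul_apply, map_mul, map_mul, J.counit_right, J.counit_right_inv,
      applyRight_comul, one_mul, mul_one]
  exact this.trans (by simp)

/-- The underlying type of the twisted Hopf algebra `A^J`, a copy of `A`. -/
def Twisted (_J : NormalizedTwist k A) : Type _ := A

instance : Ring J.Twisted := inferInstanceAs (Ring A)
instance : Algebra k J.Twisted := inferInstanceAs (Algebra k A)

/-- The identity map, as an isomorphism of algebras `A ≃ A^J`. -/
def toTwisted : A ≃ₐ[k] J.Twisted := AlgEquiv.refl

theorem antipode_left (a : A) :
    LinearMap.mul' k A (J.twistedAntipode.rTensor A (J.twistedComul a)) =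
      counit (R := k) a • (1 : A) := by
  have key : ∀ X : A ⊗[k] A, LinearMap.mul' k A (J.twistedAntipode.rTensor A X) =
      (↑J.Q⁻¹ : A) * antipodeMul ((J.J : A ⊗[k] A) * X) := by
    intro X
    rw [antipodeMul_mul _ X (J.Q : A) rfl]
    induction X with
    | zero => simp
    | add X X' hX hX' => simp only [map_add, mul_add, hX, hX']
    | tmul x y => simp [twistedAntipode_apply, mul_assoc]
  rw [key, twistedComul_apply, mul_assoc, Units.mul_inv_cancel_left,
    antipodeMul_mul _ _ _ (antipodeMul_comul a)]
  have : ∀ X : A ⊗[k] A, LinearMap.mul' k A (TensorProduct.map (antipode k)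
      (LinearMap.mulLeft k (counit (R := k) a • (1 : A))) X) =
      counit (R := k) a • antipodeMul X := by
    intro X
    induction X with
    | zero => simp
    | add X X' hX hX' => simp only [map_add, smul_add, hX, hX']
    | tmul x y => simp
  rw [this, mul_smul_comm]
  exact congrArg _ J.Q.inv_mul

theorem antipode_right (a : A) :
    LinearMap.mul' k A (J.twistedAntipode.lTensor A (J.twistedComul a)) =
      counit (R := k) a • (1 : A) := by
  have key : ∀ X : A ⊗[k] A, LinearMap.mul' k A (J.twistedAntipode.lTensor A X) =
      mulAntipode (X * (↑J.J⁻¹ : A ⊗[k] A)) * (J.Q : A) := by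
    intro X
    rw [mulAntipode_mul X _ (↑J.Q⁻¹ : A) rfl]
    induction X with
    | zero => simp
    | add X X' hX hX' => simp only [map_add, add_mul, hX, hX']
    | tmul x y => simp [twistedAntipode_apply, mul_assoc]
  rw [key, twistedComul_apply, Units.mul_inv_cancel_right,
    mulAntipode_mul _ _ _ (mulAntipode_comul a)]
  have : ∀ X : A ⊗[k] A, LinearMap.mul' k A (TensorProduct.map
      (LinearMap.mulRight k (counit (R := k) a • (1 : A))) (antipode k) X) =
      counit (R := k) a • mulAntipode X := by
    intro X
    induction X with
    | zero => simp
    | add X X' hX hX' => simp only [map_add, smul_add, hX, hX']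
    | tmul x y => simp
  rw [this, smul_mul_assoc]
  exact congrArg _ J.Q.inv_mul

/-- The coalgebra structure `(Δ^J, ε)` of `A^J`. -/
instance : Coalgebra k J.Twisted where
  comul := J.twistedComul.toLinearMap
  counit := (counit : A →ₗ[k] k)
  coassoc := LinearMap.ext J.twistedComul_coassoc
  rTensor_counit_comp_comul := LinearMap.ext J.rTensor_counit_twistedComul
  lTensor_counit_comp_comul := LinearMap.ext J.lTensor_counit_twistedComul

/-- The bialgebra structure of `A^J`. -/
instance : Bialgebra k J.Twisted :=
  Bialgebra.mk' k J.Twisted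
    (Bialgebra.counit_one (R := k) (A := A))
    (fun {a b} => Bialgebra.counit_mul (R := k) (A := A) a b)
    (map_one J.twistedComul)
    (fun {a b} => map_mul J.twistedComul a b)

/-- The twisted Hopf algebra `A^J`: the algebra structure and counit of `A`, the
comultiplication `Δ^J` and the antipode `S^J`. -/
instance : HopfAlgebra k J.Twisted where
  antipode := J.twistedAntipode
  mul_antipode_rTensor_comul :=
    LinearMap.ext fun a => (J.antipode_left a).trans (Algebra.algebraMap_eq_smul_one _).symm
  mul_antipode_lTensor_comul :=
    LinearMap.ext fun a => (J.antipode_right a).trans (Algebra.algebraMap_eq_smul_one _).symm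

theorem comul_toTwisted (a : A) :
    comul (R := k) (J.toTwisted a) =
      TensorProduct.map J.toTwisted.toLinearMap J.toTwisted.toLinearMap
        ((↑J.J⁻¹ : A ⊗[k] A) * comul (R := k) a * (J.J : A ⊗[k] A)) := by
  rw [← twistedComul_apply]
  exact (LinearMap.congr_fun (TensorProduct.map_id (R := k) (M := A) (N := A))
    (J.twistedComul a)).symm

theorem counit_toTwisted (a : A) :
    counit (R := k) (J.toTwisted a) = counit (R := k) a := rfl

theorem antipode_toTwisted (a : A) :
    antipode k (J.toTwisted a) = J.toTwisted ((↑J.Q⁻¹ : A) * antipode k a * (J.Q : A)) :=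
  congrArg J.toTwisted (J.twistedAntipode_apply a)

/-- The functional `λ^J = λ ↼ S²(R⁻¹) S(Q_J⁻¹) Q_J`, as a functional on `A^J`. -/
def twistedFunctional (α : A →ₐ[k] k) (f : Module.Dual k A) : Module.Dual k J.Twisted :=
  rightAct f (antipode k (antipode k (↑(J.R α)⁻¹ : A)) * antipode k (↑J.Q⁻¹ : A) * (J.Q : A)) ∘ₗ
    J.toTwisted.symm.toLinearMap

end NormalizedTwist

end Twist

end HopfTwist

end

/-! A right integral `f` of `A^*` satisfies f(a₁)a₂ = f(a)1, and hence f(b₁a)b₂ = S(f(ba₁)a₂)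
(`contract_comul_mul`). This exchange rule makes a nonzero `f` nondegenerate, so `A` is a Frobenius
algebra with form `f`. From this come a left integral Λ with f(Λ) = 1, unique up to scalars, the
character α given by Λa = α(a)Λ, the injectivity of S, and the Nakayama automorphism f(ba) =
f(S²(α(a₁)a₂)b) (`apply_mul`).

For the twist, put u = S²(R⁻¹)S(Q⁻¹)Q. The claim is that contracting J⁻¹Δ(a)J with λ(u·) gives
λ(ua)1. Since S is injective, it may be checked after applying S. The Nakayama automorphism moves
the first leg of J to the front and the exchange rule moves Δ from a to the other factors
(`antipode_contract_mul_comul_mul`). What remains is the contraction with λ(·a) of a tensor built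
from J, J⁻¹ and Δ(u). The cocycle equation gives Δ(Q), Δ(R) and the outer factors in terms of J, so
this tensor collapses to u ⊗ 1 (`translateMul_mul_comul_mul`). The functional is nonzero because u
is invertible. -/

open scoped TensorProduct

noncomputable section

namespace HopfTwist

open Coalgebra Bialgebra HopfAlgebra

/-! ### Contraction with a functional; right integrals of the dual -/

section Contraction

variable {k A : Type*} [Field k] [Ring A]

/-- The contraction `x ⊗ y ↦ f(x) y` of a tensor with a functional `f`. -/
def contract [Algebra k A] (f : Module.Dual k A) : A ⊗[k] A →ₗ[k] A :=
  TensorProduct.lid k A ∘ₗ f.rTensor A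

@[simp] theorem contract_tmul [Algebra k A] (f : Module.Dual k A) (x y : A) :
    contract f (x ⊗ₜ[k] y) = f x • y := by simp [contract]

theorem contract_mul_one_tmul [Algebra k A] (f : Module.Dual k A) (X : A ⊗[k] A) (y : A) :
    contract f (X * (1 ⊗ₜ[k] y)) = contract f X * y := by
  induction X with
  | zero => simp
  | add X X' hX hX' => simp only [map_add, add_mul, hX, hX']
  | tmul x z => simp

theorem contract_one_tmul_mul [Algebra k A] (f : Module.Dual k A) (X : A ⊗[k] A) (y : A) :
    contract f ((1 ⊗ₜ[k] y) * X) = y * contract f X := by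
  induction X with
  | zero => simp
  | add X X' hX hX' => simp only [map_add, mul_add, hX, hX']
  | tmul x z => simp

theorem contract_mulRight [Algebra k A] (f : Module.Dual k A) (X : A ⊗[k] A) (a : A) :
    contract (f ∘ₗ LinearMap.mulRight k a) X = contract f (X * (a ⊗ₜ[k] 1)) := by
  induction X with
  | zero => simp
  | add X X' hX hX' => simp only [map_add, add_mul, hX, hX']
  | tmul x z => simp

theorem contract_mulLeft [Algebra k A] (f : Module.Dual k A) (X : A ⊗[k] A) (a : A) :
    contract (f ∘ₗ LinearMap.mulLeft k a) X = contract f ((a ⊗ₜ[k] 1) * X) := by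
  induction X with
  | zero => simp
  | add X X' hX hX' => simp only [map_add, mul_add, hX, hX']
  | tmul x z => simp

/-- `f` is a right integral in `A^*` if and only if `f(a₁) a₂ = f(a) 1` for all `a ∈ A`. -/
theorem isRightIntegralInDual_iff [Bialgebra k A] (f : Module.Dual k A) :
    IsRightIntegralInDual f ↔ ∀ a : A, contract f (comul (R := k) a) = f a • (1 : A) := by
  have key : ∀ (g : Module.Dual k A) (X : A ⊗[k] A),
      LinearMap.mul' k k (TensorProduct.map f g X) = g (contract f X) := by
    intro g X
    induction X with
    | zero => simp
    | add X X' hX hX' => simp only [map_add, hX, hX']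
    | tmul x y => simp
  constructor
  · intro h a
    refine Module.forall_dual_apply_eq_zero_iff k _ |>.1 (fun g => ?_) |> sub_eq_zero.1
    have := congrArg (fun F => F.ofConv a) (h g)
    simp only [LinearMap.convMul_apply, key] at this
    rw [map_sub, this]
    simp [mul_comm]
  · intro h g
    refine WithConv.ext (LinearMap.ext fun a => ?_)
    have : (WithConv.toConv f * WithConv.toConv g).ofConv a = g (contract f (comul a)) := by
      rw [← key, LinearMap.convMul_apply]
    rw [this, h]
    simp [mul_comm]

end Contraction

/-! ### Antipode calculus on tensors -/

section Antipode

variable {k A : Type*} [Field k] [Ring A] [HopfAlgebra k A]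

theorem comulLeft_tmul (x y : A) :
    comulLeft (x ⊗ₜ[k] y) =
      Algebra.TensorProduct.assoc k k k A A A (comul (R := k) x ⊗ₜ[k] y) := rfl

theorem comulLeft_tmul_mul_tmulOne (x y : A) (Z : A ⊗[k] A) :
    comulLeft (x ⊗ₜ[k] y) * tmulOne Z =
      Algebra.TensorProduct.assoc k k k A A A ((comul (R := k) x * Z) ⊗ₜ[k] y) := by
  rw [← mul_one y, ← Algebra.TensorProduct.tmul_mul_tmul, map_mul, mul_one]
  rfl

theorem comulRight_tmul (x y : A) :
    comulRight (x ⊗ₜ[k] y) = x ⊗ₜ[k] comul (R := k) y := rfl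

/-- The square of the antipode, as an algebra map. -/
def antipodeSq : A →ₐ[k] A :=
  AlgHom.ofLinearMap (antipode k ∘ₗ antipode k) (by simp)
    (fun a b => by simp [antipode_mul_antidistrib])

@[simp] theorem antipodeSq_apply (a : A) :
    antipodeSq (k := k) a = antipode k (antipode k a) := rfl

/-- The map `x ⊗ y ↦ S(y) ⊗ S(x)`. -/
def antipodeSwap : A ⊗[k] A →ₗ[k] A ⊗[k] A :=
  TensorProduct.map (antipode k) (antipode k) ∘ₗ (TensorProduct.comm k A A).toLinearMap

@[simp] theorem antipodeSwap_tmul (x y : A) :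
    antipodeSwap (k := k) (x ⊗ₜ[k] y) = antipode k y ⊗ₜ[k] antipode k x := by
  simp [antipodeSwap]

theorem antipodeSwap_mul (X Y : A ⊗[k] A) :
    antipodeSwap (X * Y) = antipodeSwap Y * antipodeSwap X := by
  induction X with
  | zero => simp
  | add X X' hX hX' => simp only [map_add, add_mul, mul_add, hX, hX']
  | tmul x y =>
    induction Y with
    | zero => simp
    | add Y Y' hY hY' => simp only [map_add, add_mul, mul_add, hY, hY']
    | tmul z w => simp [antipode_mul_antidistrib]

theorem antipodeSwap_antipodeSwap (X : A ⊗[k] A) :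
    antipodeSwap (antipodeSwap X) = Algebra.TensorProduct.map (antipodeSq (k := k)) antipodeSq X := by
  induction X with
  | zero => simp
  | add X X' hX hX' => simp only [map_add, hX, hX']
  | tmul x y => simp

/-- The map `x ⊗ y ⊗ z ↦ S(x) y ⊗ z`. -/
def antipodeMulLeft : A ⊗[k] (A ⊗[k] A) →ₗ[k] A ⊗[k] A :=
  antipodeMul.rTensor A ∘ₗ (TensorProduct.assoc k A A A).symm.toLinearMap

theorem antipodeMulLeft_tmul (x : A) (Y : A ⊗[k] A) :
    antipodeMulLeft (x ⊗ₜ[k] Y) = (antipode k x ⊗ₜ[k] 1) * Y := by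
  induction Y with
  | zero => simp
  | add Y Y' hY hY' => simp only [map_add, TensorProduct.tmul_add, mul_add, hY, hY']
  | tmul y z => simp [antipodeMulLeft]

theorem antipodeMulLeft_assoc (X : A ⊗[k] A) (y : A) :
    antipodeMulLeft (Algebra.TensorProduct.assoc k k k A A A (X ⊗ₜ[k] y)) =
      antipodeMul X ⊗ₜ[k] y := by
  induction X with
  | zero => simp
  | add X X' hX hX' => simp only [map_add, TensorProduct.add_tmul, hX, hX']
  | tmul x z => simp [antipodeMulLeft]

/-- The map `x ⊗ y ↦ Δ(x) (1 ⊗ S(y))`. -/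
def comulMulAntipode : A ⊗[k] A →ₗ[k] A ⊗[k] A :=
  mulAntipode.lTensor A ∘ₗ comulLeft.toLinearMap

theorem lTensor_mulAntipode_assoc (X : A ⊗[k] A) (y : A) :
    mulAntipode.lTensor A (Algebra.TensorProduct.assoc k k k A A A (X ⊗ₜ[k] y)) =
      X * (1 ⊗ₜ[k] antipode k y) := by
  induction X with
  | zero => simp
  | add X X' hX hX' => simp only [map_add, TensorProduct.add_tmul, add_mul, hX, hX']
  | tmul x z => simp

theorem comulMulAntipode_tmul (x y : A) :
    comulMulAntipode (x ⊗ₜ[k] y) = comul (R := k) x * (1 ⊗ₜ[k] antipode k y) := by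
  rw [← lTensor_mulAntipode_assoc, ← comulLeft_tmul]
  rfl

theorem antipodeMul_mul_comul (X : A ⊗[k] A) (a : A) :
    antipodeMul (comul (R := k) a * X) = counit (R := k) a • antipodeMul X := by
  rw [antipodeMul_mul _ _ _ (antipodeMul_comul a)]
  induction X with
  | zero => simp
  | add X X' hX hX' => simp only [map_add, smul_add, hX, hX']
  | tmul x y => simp

theorem mulAntipode_mul_comul (X : A ⊗[k] A) (a : A) :
    mulAntipode (X * comul (R := k) a) = counit (R := k) a • mulAntipode X := by
  rw [mulAntipode_mul _ _ _ (mulAntipode_comul a)]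
  induction X with
  | zero => simp
  | add X X' hX hX' => simp only [map_add, smul_add, hX, hX']
  | tmul x y => simp

theorem lTensor_mulAntipode_oneTmul_mul_comulRight (X Y : A ⊗[k] A) :
    mulAntipode.lTensor A (oneTmul X * comulRight Y) =
      applyRight (counitAlgHom k A) Y ⊗ₜ[k] mulAntipode X := by
  induction Y with
  | zero => simp
  | add Y Y' hY hY' => simp only [map_add, mul_add, TensorProduct.add_tmul, hY, hY']
  | tmul x y => simp [comulRight, mulAntipode_mul_comul, TensorProduct.smul_tmul']

theorem lTensor_mulAntipode_tmulOne_mul (X : A ⊗[k] A) (W : A ⊗[k] (A ⊗[k] A)) :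
    mulAntipode.lTensor A (tmulOne X * W) = X * mulAntipode.lTensor A W := by
  induction X with
  | zero => simp
  | add X X' hX hX' => simp only [map_add, add_mul, hX, hX']
  | tmul x y =>
    induction W with
    | zero => simp
    | add W W' hW hW' => simp only [map_add, mul_add, hW, hW']
    | tmul p V =>
      induction V with
      | zero => simp
      | add W W' hW hW' => simp only [map_add, mul_add, TensorProduct.tmul_add, hW, hW']
      | tmul q r => simp [mul_assoc]

/-- By coassociativity a₁ ⊗ a₂S(a₃) = a ⊗ 1. Used to replace a ⊗ 1 by Δ(a₁)(1 ⊗ S(a₂)), so that a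
can be absorbed into a neighbouring coproduct. -/
theorem comulMulAntipode_comul (a : A) :
    comulMulAntipode (comul (R := k) a) = a ⊗ₜ[k] 1 := by
  have h := lTensor_mulAntipode_oneTmul_mul_comulRight (k := k) 1 (comul (R := k) a)
  rw [map_one, one_mul, ← NormalizedTwist.comulLeft_comul, NormalizedTwist.applyRight_comul] at h
  simpa [comulMulAntipode, Algebra.TensorProduct.one_def] using h

theorem antipodeMulLeft_comulLeft_mul_tmulOne (X Z : A ⊗[k] A) :
    antipodeMulLeft (comulLeft X * tmulOne Z) =
      antipodeMul Z ⊗ₜ[k] applyLeft (counitAlgHom k A) X := by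
  induction X with
  | zero => simp
  | add X X' hX hX' => simp only [map_add, add_mul, TensorProduct.tmul_add, hX, hX']
  | tmul x y =>
    rw [comulLeft_tmul_mul_tmulOne, antipodeMulLeft_assoc, antipodeMul_mul_comul]
    simp [TensorProduct.smul_tmul']

theorem antipodeMulLeft_comulRight_comul (a : A) :
    antipodeMulLeft (comulRight (comul (R := k) a)) = 1 ⊗ₜ[k] a := by
  have h := antipodeMulLeft_comulLeft_mul_tmulOne (comul (R := k) a) (1 : A ⊗[k] A)
  rw [map_one, mul_one, NormalizedTwist.comulLeft_comul, NormalizedTwist.applyLeft_comul] at h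
  simpa [Algebra.TensorProduct.one_def] using h

/-- The argument has the shape that the cocycle equation gives to (Δ ⊗ id)(J). The antipode reverses
products, so the coproduct of the second leg of Y collapses to its counit. -/
theorem lTensor_antipodeMul_comulRight_mul (X Y Z : A ⊗[k] A) :
    antipodeMul.lTensor A (comulRight Y * oneTmul X * tmulOne Z) =
      (applyRight (counitAlgHom k A) Y ⊗ₜ[k] 1) * (antipode k).lTensor A Z *
        (1 ⊗ₜ[k] antipodeMul X) := by
  have key : ∀ (W : A ⊗[k] A) (f : A),
      antipodeMul (W * (f ⊗ₜ[k] 1)) = antipode k f * antipodeMul W := by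
    intro W f
    induction W with
    | zero => simp
    | add X X' hX hX' => simp only [map_add, add_mul, mul_add, hX, hX']
    | tmul x y => simp [antipode_mul_antidistrib, mul_assoc]
  induction Y with
  | zero => simp
  | add Y Y' hY hY' => simp only [map_add, add_mul, TensorProduct.add_tmul, hY, hY']
  | tmul x y =>
    induction Z with
    | zero => simp
    | add Z Z' hZ hZ' => simp only [map_add, add_mul, mul_add, hZ, hZ']
    | tmul z w =>
      simp [comulRight, key, antipodeMul_mul_comul, TensorProduct.smul_tmul']

/-- The map `x ⊗ y ⊗ z ↦ (S(y) ⊗ S(x)) Δ(z)`. -/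
def antipodeSwapMulComul : A ⊗[k] (A ⊗[k] A) →ₗ[k] A ⊗[k] A :=
  LinearMap.mul' k (A ⊗[k] A) ∘ₗ TensorProduct.map antipodeSwap comul ∘ₗ
    (TensorProduct.assoc k A A A).symm.toLinearMap

theorem antipodeSwapMulComul_assoc (W : A ⊗[k] A) (z : A) :
    antipodeSwapMulComul (Algebra.TensorProduct.assoc k k k A A A (W ⊗ₜ[k] z)) =
      antipodeSwap W * comul (R := k) z := by
  induction W with
  | zero => simp
  | add W W' hW hW' => simp only [map_add, add_mul, TensorProduct.add_tmul, hW, hW']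
  | tmul x y => simp [antipodeSwapMulComul]

theorem antipodeSwapMulComul_tmul (x : A) (V : A ⊗[k] A) :
    antipodeSwapMulComul (x ⊗ₜ[k] V) =
      (1 ⊗ₜ[k] antipode k x) * antipodeMulLeft (comulRight V) := by
  induction V with
  | zero => simp
  | add W W' hW hW' => simp only [map_add, mul_add, TensorProduct.tmul_add, hW, hW']
  | tmul y z =>
    rw [comulRight_tmul, antipodeMulLeft_tmul, ← mul_assoc]
    simp [antipodeSwapMulComul]

theorem antipodeMulLeft_mul_oneTmul (W : A ⊗[k] (A ⊗[k] A)) (Z : A ⊗[k] A) :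
    antipodeMulLeft (W * oneTmul Z) = antipodeMulLeft W * Z := by
  induction W with
  | zero => simp
  | add W W' hW hW' => simp only [map_add, add_mul, hW, hW']
  | tmul x Y => simp [antipodeMulLeft_tmul, mul_assoc]

/-- The antipode is an antihomomorphism of coalgebras. -/
theorem comul_antipode (a : A) :
    comul (R := k) (antipode k a) = antipodeSwap (comul (R := k) a) := by
  -- Both sides of the claim are convolution inverses of Δ in Hom(A, A ⊗ A): here the swapped
  -- antipode is a left inverse, and Δ ∘ S is a right inverse.
  have h : WithConv.toConv (antipodeSwap ∘ₗ comul) *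
      WithConv.toConv (comul : A →ₗ[k] A ⊗[k] A) = 1 := by
    refine WithConv.ext (LinearMap.ext fun a => ?_)
    have h₁ : ∀ X : A ⊗[k] A, LinearMap.mul' k (A ⊗[k] A)
        (TensorProduct.map (antipodeSwap ∘ₗ comul) comul X) =
        antipodeSwapMulComul (comulLeft X) := by
      intro X
      induction X with
      | zero => simp
      | add X X' hX hX' => simp only [map_add, hX, hX']
      | tmul x y =>
        rw [comulLeft_tmul, antipodeSwapMulComul_assoc]
        rfl
    have h₂ : ∀ X : A ⊗[k] A,
        antipodeSwapMulComul (comulRight X) = (1 ⊗ₜ[k] antipodeMul X) := by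
      intro X
      induction X with
      | zero => simp
      | add X X' hX hX' => simp only [map_add, TensorProduct.tmul_add, hX, hX']
      | tmul x y =>
        rw [comulRight_tmul, antipodeSwapMulComul_tmul, antipodeMulLeft_comulRight_comul]
        simp
    rw [LinearMap.convMul_apply]
    refine (h₁ _).trans ?_
    rw [NormalizedTwist.comulLeft_comul, h₂, antipodeMul_comul]
    simp [LinearMap.convOne_apply, Algebra.algebraMap_eq_smul_one, Algebra.TensorProduct.one_def]
  have := left_inv_eq_right_inv h LinearMap.comul_right_inv
  exact (LinearMap.congr_fun (congrArg WithConv.ofConv this) a).symm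

theorem comul_antipodeSq (a : A) :
    comul (R := k) (antipode k (antipode k a)) =
      Algebra.TensorProduct.map (antipodeSq (k := k)) antipodeSq (comul (R := k) a) := by
  rw [comul_antipode, comul_antipode, antipodeSwap_antipodeSwap]

end Antipode

/-! ### Right integrals of the dual: exchange rule and nondegeneracy -/

section RightIntegral

variable {k A : Type*} [Field k] [Ring A] [HopfAlgebra k A] {f : Module.Dual k A}

theorem IsRightIntegralInDual.contract_comul (hf : IsRightIntegralInDual f) (a : A) :
    contract f (comul (R := k) a) = f a • (1 : A) :=
  (isRightIntegralInDual_iff f).1 hf a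

/-- For a right integral `f` of `A^*`, one has `f(b₁ a) b₂ = f(b a₁) S(a₂)`. -/
theorem IsRightIntegralInDual.contract_comul_mul (hf : IsRightIntegralInDual f) (a b : A) :
    contract f (comul (R := k) b * (a ⊗ₜ[k] 1)) =
      antipode k (contract f ((b ⊗ₜ[k] 1) * comul (R := k) a)) := by
  -- With a ⊗ 1 = Δ(a₁)(1 ⊗ S(a₂)), the product becomes Δ(ba₁)(1 ⊗ S(a₂)), whose coproduct the
  -- integral contracts to f(ba₁).
  have key : ∀ X : A ⊗[k] A, contract f (comul (R := k) b * comulMulAntipode X) =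
      antipode k (contract f ((b ⊗ₜ[k] 1) * X)) := by
    intro X
    induction X with
    | zero => simp
    | add X X' hX hX' => simp only [map_add, mul_add, hX, hX']
    | tmul x y =>
      rw [comulMulAntipode_tmul, ← mul_assoc, ← comul_mul, contract_mul_one_tmul,
        hf.contract_comul]
      simp
  rw [← key, comulMulAntipode_comul]

/-- A nonzero right integral of `A^*` is nondegenerate. -/
theorem IsRightIntegralInDual.eq_zero_of_forall [FiniteDimensional k A] (hf : IsRightIntegralInDual f) (hf0 : f ≠ 0)
    {b : A} (hb : ∀ a, f (b * a) = 0) : b = 0 := by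
  let T : A →ₗ[k] Module.Dual k A := LinearMap.compr₂ (LinearMap.mul k A) f
  -- The kernel is a right coideal. Viewing `A^* ⊗ A` as End(A), the claim is f(c₁a)c₂ = 0 for all
  -- a, which is the exchange rule.
  have hT : ∀ c ∈ LinearMap.ker T, T.rTensor A (comul (R := k) c) = 0 := by
    intro c hc
    refine dualTensorHom_bijective.1 ((LinearMap.ext fun a => ?_).trans (map_zero _).symm)
    have h₁ : ∀ X : A ⊗[k] A, dualTensorHom k A A (T.rTensor A X) a =
        contract f (X * (a ⊗ₜ[k] 1)) := by
      intro X
      induction X with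
      | zero => simp
      | add X X' hX hX' => simp only [map_add, add_mul, LinearMap.add_apply, hX, hX']
      | tmul x y => simp [T]
    have h₂ : ∀ X : A ⊗[k] A, contract f ((c ⊗ₜ[k] 1) * X) = 0 := by
      intro X
      induction X with
      | zero => simp
      | add X X' hX hX' => simp only [map_add, mul_add, hX, hX', add_zero]
      | tmul x y =>
        have : f (c * x) = 0 := LinearMap.congr_fun hc x
        simp [this]
    rw [h₁, hf.contract_comul_mul, h₂, map_zero, LinearMap.zero_apply]
  -- The counit factors through `T` if it vanishes on the kernel. For c in the kernel, 0 =
  -- f(c₁S(c₂)a) = ε(c)f(a), so ε(c) ≠ 0 would force f = 0.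
  have hcounit : (counit : Module.Dual k A) ∈ LinearMap.range T.dualMap := by
    rw [LinearMap.range_dualMap_eq_dualAnnihilator_ker, Submodule.mem_dualAnnihilator]
    intro c hc
    by_contra h
    refine hf0 (LinearMap.ext fun a => ?_)
    let Φ : Module.Dual k A ⊗[k] A →ₗ[k] k :=
      TensorProduct.lift ((LinearMap.lcomp k k (LinearMap.mulRight k a ∘ₗ antipode k)))
    have hΦ : ∀ X : A ⊗[k] A, Φ (T.rTensor A X) = f (mulAntipode X * a) := by
      intro X
      induction X with
      | zero => simp
      | add X X' hX hX' => simp only [map_add, add_mul, hX, hX']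
      | tmul x y => simp [Φ, T, mul_assoc]
    have := hΦ (comul c)
    rw [hT c hc, mulAntipode_comul] at this
    simpa [h] using this.symm
  obtain ⟨e, he⟩ := hcounit
  -- With ε = e ∘ T, one gets b = ε(b₁)b₂ = e(T(b₁))b₂, which vanishes when T(b) = 0 by the coideal
  -- property.
  have key : ∀ X : A ⊗[k] A, TensorProduct.lid k A (e.rTensor A (T.rTensor A X)) =
      applyLeft (counitAlgHom k A) X := by
    intro X
    induction X with
    | zero => simp
    | add X X' hX hX' => simp only [map_add, hX, hX']
    | tmul x y => simp [← he]
  have := key (comul b)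
  rwa [hT b (LinearMap.ext hb), NormalizedTwist.applyLeft_comul, map_zero, map_zero,
    eq_comm] at this

theorem IsLeftIntegral.mul_right {Λ : A} (hΛ : IsLeftIntegral k Λ) (a : A) :
    IsLeftIntegral k (Λ * a) := fun b => by
  rw [← mul_assoc, hΛ, smul_mul_assoc]

/-- Write 1 ⊗ a = (S(a₁) ⊗ 1)Δ(a₂) and absorb a₂ into Λ. -/
theorem IsLeftIntegral.one_tmul_mul_comul {Λ : A} (hΛ : IsLeftIntegral k Λ) (a : A) :
    (1 ⊗ₜ[k] a) * comul (R := k) Λ = (antipode k a ⊗ₜ[k] 1) * comul (R := k) Λ := by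
  have key : ∀ X : A ⊗[k] A, antipodeMulLeft (comulRight X) * comul (R := k) Λ =
      (antipode k (applyRight (counitAlgHom k A) X) ⊗ₜ[k] 1) * comul (R := k) Λ := by
    intro X
    induction X with
    | zero => simp
    | add X X' hX hX' => simp only [map_add, add_mul, TensorProduct.add_tmul, hX, hX']
    | tmul x y =>
      rw [comulRight_tmul, antipodeMulLeft_tmul, mul_assoc, ← comul_mul, hΛ]
      simp [← TensorProduct.smul_tmul']
  rw [← antipodeMulLeft_comulRight_comul, key, NormalizedTwist.applyRight_comul]

/-- The left action `a ↦ α(a₁) a₂` of a group-like element of `A^*`. -/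
def translate (α : A →ₐ[k] k) : A →ₐ[k] A := (applyLeft α).comp (comulAlgHom k A)

theorem translate_apply (α : A →ₐ[k] k) (a : A) :
    translate α a = applyLeft α (comul (R := k) a) := rfl

/-- Write a ⊗ 1 = Δ(a₁)(1 ⊗ S(a₂)); then Λa₁ = α(a₁)Λ leaves S(α(a₁)a₂) on the right leg. -/
theorem comul_mul_tmul_one {Λ : A} {α : A →ₐ[k] k} (hΛ : ∀ a, Λ * a = α a • Λ) (a : A) :
    comul (R := k) Λ * (a ⊗ₜ[k] 1) =
      comul (R := k) Λ * (1 ⊗ₜ[k] antipode k (translate α a)) := by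
  have key : ∀ X : A ⊗[k] A, comul (R := k) Λ * comulMulAntipode X =
      comul (R := k) Λ * (1 ⊗ₜ[k] antipode k (applyLeft α X)) := by
    intro X
    induction X with
    | zero => simp
    | add X X' hX hX' => simp only [map_add, mul_add, TensorProduct.tmul_add, hX, hX']
    | tmul x y =>
      rw [comulMulAntipode_tmul, ← mul_assoc, ← comul_mul, hΛ]
      simp
  rw [← comulMulAntipode_comul, key, translate_apply]

/-- Since f(S(a)Λ₁)Λ₂ = a f(Λ₁)Λ₂ = a, this is an explicit left inverse of S. -/
theorem IsRightIntegralInDual.contract_antipode_comul (hf : IsRightIntegralInDual f) {Λ : A}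
    (hΛ : IsLeftIntegral k Λ) (h1 : f Λ = 1) (a : A) :
    contract (rightAct f (antipode k a)) (comul (R := k) Λ) = a := by
  rw [rightAct, contract_mulLeft, ← hΛ.one_tmul_mul_comul, contract_one_tmul_mul,
    hf.contract_comul, h1, one_smul, mul_one]

end RightIntegral

/-! ### Frobenius structure, distinguished character, Nakayama automorphism -/

section FiniteDimensional

variable {k A : Type*} [Field k] [Ring A] [HopfAlgebra k A] [FiniteDimensional k A]
  {f : Module.Dual k A}

theorem IsRightIntegralInDual.exists_rightAct_eq (hf : IsRightIntegralInDual f) (hf0 : f ≠ 0)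
    (g : Module.Dual k A) : ∃ a : A, rightAct f a = g := by
  let T : A →ₗ[k] Module.Dual k A := LinearMap.compr₂ (LinearMap.mul k A) f
  have hT : Function.Injective T := by
    refine (injective_iff_map_eq_zero T).2 fun b hb =>
      hf.eq_zero_of_forall hf0 fun a => LinearMap.congr_fun hb a
  obtain ⟨a, ha⟩ := (LinearMap.injective_iff_surjective_of_finrank_eq_finrank
    Subspace.dual_finrank_eq.symm).1 hT g
  exact ⟨a, ha⟩

theorem IsRightIntegralInDual.eq_zero_of_forall' (hf : IsRightIntegralInDual f) (hf0 : f ≠ 0)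
    {b : A} (hb : ∀ a, f (a * b) = 0) : b = 0 := by
  refine (Module.forall_dual_apply_eq_zero_iff k b).1 fun g => ?_
  obtain ⟨a, rfl⟩ := hf.exists_rightAct_eq hf0 g
  exact hb a

theorem IsRightIntegralInDual.exists_mulRight_eq (hf : IsRightIntegralInDual f) (hf0 : f ≠ 0)
    (g : Module.Dual k A) : ∃ a : A, ∀ x, f (x * a) = g x := by
  let T : A →ₗ[k] Module.Dual k A := LinearMap.compr₂ (LinearMap.mul k A).flip f
  have hT : Function.Injective T := by
    refine (injective_iff_map_eq_zero T).2 fun b hb =>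
      hf.eq_zero_of_forall' hf0 fun a => LinearMap.congr_fun hb a
  obtain ⟨a, ha⟩ := (LinearMap.injective_iff_surjective_of_finrank_eq_finrank
    Subspace.dual_finrank_eq.symm).1 hT g
  exact ⟨a, LinearMap.congr_fun ha⟩

/-- There is a left integral `Λ` with `f(x Λ) = ε(x)`. -/
theorem IsRightIntegralInDual.exists_isLeftIntegral (hf : IsRightIntegralInDual f)
    (hf0 : f ≠ 0) : ∃ Λ : A, IsLeftIntegral k Λ ∧ f Λ = 1 := by
  obtain ⟨Λ, hΛ⟩ := hf.exists_mulRight_eq hf0 (counit : Module.Dual k A)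
  refine ⟨Λ, fun a => sub_eq_zero.1 (hf.eq_zero_of_forall' hf0 fun x => ?_), ?_⟩
  · rw [mul_sub, map_sub, ← mul_assoc, hΛ, mul_smul_comm, map_smul, hΛ]
    simp [mul_comm]
  · simpa using hΛ 1

/-- Both sides pair with every x to ε(x)f(Λ'), and f is nondegenerate. -/
theorem IsRightIntegralInDual.eq_smul (hf : IsRightIntegralInDual f) (hf0 : f ≠ 0)
    {Λ Λ' : A} (hΛ : IsLeftIntegral k Λ) (h1 : f Λ = 1) (hΛ' : IsLeftIntegral k Λ') :
    Λ' = f Λ' • Λ := by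
  refine sub_eq_zero.1 (hf.eq_zero_of_forall' hf0 fun x => ?_)
  rw [mul_sub, map_sub, hΛ', mul_smul_comm, hΛ]
  simp [h1, mul_comm]

theorem IsRightIntegralInDual.isDistinguishedGroupLike_iff (hf : IsRightIntegralInDual f)
    (hf0 : f ≠ 0) {Λ : A} (hΛ : IsLeftIntegral k Λ) (h1 : f Λ = 1) (α : A →ₐ[k] k) :
    IsDistinguishedGroupLike α ↔ ∀ a, Λ * a = α a • Λ := by
  constructor
  · rintro ⟨Λ', hΛ', h0, h⟩ a
    have h2 := hf.eq_smul hf0 hΛ h1 hΛ'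
    have h3 : f Λ' ≠ 0 := fun h3 => h0 (by rw [h2, h3, zero_smul])
    have h4 := h a
    rw [h2, smul_mul_assoc, smul_comm] at h4
    exact smul_right_injective A h3 h4
  · intro h
    refine ⟨Λ, hΛ, ?_, h⟩
    rintro rfl
    simp at h1

theorem IsRightIntegralInDual.existsUnique_isDistinguishedGroupLike
    (hf : IsRightIntegralInDual f) (hf0 : f ≠ 0) :
    ∃! α : A →ₐ[k] k, IsDistinguishedGroupLike α := by
  obtain ⟨Λ, hΛ, h1⟩ := hf.exists_isLeftIntegral hf0
  -- Λa is again a left integral, hence a multiple of Λ; this forces α(a) = f(Λa).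
  have hmul : ∀ a, Λ * a = f (Λ * a) • Λ := fun a => hf.eq_smul hf0 hΛ h1 (hΛ.mul_right a)
  simp only [hf.isDistinguishedGroupLike_iff hf0 hΛ h1]
  refine ⟨AlgHom.ofLinearMap (f ∘ₗ LinearMap.mulLeft k Λ) (by simpa using h1) fun a b => ?_,
    hmul, fun β hβ => AlgHom.ext fun a => ?_⟩
  · change f (Λ * (a * b)) = f (Λ * a) * f (Λ * b)
    rw [← mul_assoc, hmul a, smul_mul_assoc, map_smul, smul_eq_mul]
    simp [h1]
  · change β a = f (Λ * a)
    rw [hβ a, map_smul, h1, smul_eq_mul, mul_one]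

/-- A finite-dimensional Hopf algebra with a nonzero right integral in its dual has a bijective
antipode. -/
theorem IsRightIntegralInDual.antipode_bijective (hf : IsRightIntegralInDual f) (hf0 : f ≠ 0) :
    Function.Bijective (antipode k : A →ₗ[k] A) := by
  obtain ⟨Λ, hΛ, h1⟩ := hf.exists_isLeftIntegral hf0
  have hinj : Function.Injective (antipode k : A →ₗ[k] A) :=
    Function.LeftInverse.injective
      (g := fun a => contract (rightAct f a) (comul (R := k) Λ))
      (hf.contract_antipode_comul hΛ h1)
  exact ⟨hinj, LinearMap.injective_iff_surjective.1 hinj⟩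

/-- The Nakayama automorphism: `f(b a) = f(S²(α(a₁) a₂) b)`. -/
theorem IsRightIntegralInDual.apply_mul (hf : IsRightIntegralInDual f) (hf0 : f ≠ 0)
    {α : A →ₐ[k] k} (hα : IsDistinguishedGroupLike α) (a b : A) :
    f (b * a) = f (antipode k (antipode k (translate α a)) * b) := by
  obtain ⟨Λ, hΛ, h1⟩ := hf.exists_isLeftIntegral hf0
  have hΛα := (hf.isDistinguishedGroupLike_iff hf0 hΛ h1 α).1 hα
  -- Write f(·a) = f(c·) with c = S(y). Contracting Δ(Λ) with this functional gives y on one side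
  -- and S(α(a₁)a₂) on the other.
  obtain ⟨c, hc⟩ := hf.exists_rightAct_eq hf0 (f ∘ₗ LinearMap.mulRight k a)
  obtain ⟨y, rfl⟩ := (hf.antipode_bijective hf0).2 c
  have hy := hf.contract_antipode_comul hΛ h1 y
  rw [hc, contract_mulRight, comul_mul_tmul_one hΛα, contract_mul_one_tmul, hf.contract_comul,
    h1, one_smul, one_mul] at hy
  rw [hy]
  exact (LinearMap.congr_fun hc b).symm

end FiniteDimensional

/-! ### Consequences of the cocycle equation -/

section TwistIdentities

variable {k A : Type*} [Field k] [Ring A] [HopfAlgebra k A]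

/-- The algebra map `x ⊗ y ⊗ z ↦ α(x) y ⊗ z`. -/
def applyFirst (α : A →ₐ[k] k) : A ⊗[k] (A ⊗[k] A) →ₐ[k] A ⊗[k] A :=
  (Algebra.TensorProduct.lid k (A ⊗[k] A)).toAlgHom.comp
    (Algebra.TensorProduct.map α (AlgHom.id k (A ⊗[k] A)))

@[simp] theorem applyFirst_tmul (α : A →ₐ[k] k) (x : A) (Y : A ⊗[k] A) :
    applyFirst α (x ⊗ₜ[k] Y) = α x • Y := by simp [applyFirst]

theorem applyFirst_oneTmul (α : A →ₐ[k] k) (X : A ⊗[k] A) : applyFirst α (oneTmul X) = X := by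
  simp

theorem applyFirst_tmulOne (α : A →ₐ[k] k) (X : A ⊗[k] A) :
    applyFirst α (tmulOne X) = applyLeft α X ⊗ₜ[k] 1 := by
  induction X with
  | zero => simp
  | add X X' hX hX' => simp only [map_add, TensorProduct.add_tmul, hX, hX']
  | tmul x y => simp [TensorProduct.smul_tmul']

theorem applyFirst_comulRight (α : A →ₐ[k] k) (X : A ⊗[k] A) :
    applyFirst α (comulRight X) = comul (R := k) (applyLeft α X) := by
  induction X with
  | zero => simp
  | add X X' hX hX' => simp only [map_add, hX, hX']
  | tmul x y => simp [comulRight_tmul]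

theorem applyFirst_assoc (α : A →ₐ[k] k) (X : A ⊗[k] A) (y : A) :
    applyFirst α (Algebra.TensorProduct.assoc k k k A A A (X ⊗ₜ[k] y)) =
      applyLeft α X ⊗ₜ[k] y := by
  induction X with
  | zero => simp
  | add X X' hX hX' => simp only [map_add, TensorProduct.add_tmul, hX, hX']
  | tmul x y => simp [TensorProduct.smul_tmul']

theorem applyFirst_comulLeft (α : A →ₐ[k] k) (X : A ⊗[k] A) :
    applyFirst α (comulLeft X) =
      Algebra.TensorProduct.map (translate α) (AlgHom.id k A) X := by
  induction X with
  | zero => simp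
  | add X X' hX hX' => simp only [map_add, hX, hX']
  | tmul x y => rw [comulLeft_tmul, applyFirst_assoc]; rfl

theorem comul_translate (α : A →ₐ[k] k) (a : A) :
    comul (R := k) (translate α a) =
      Algebra.TensorProduct.map (translate α) (AlgHom.id k A) (comul (R := k) a) := by
  rw [← applyFirst_comulLeft, NormalizedTwist.comulLeft_comul, applyFirst_comulRight,
    translate_apply]

namespace NormalizedTwist

variable (J : NormalizedTwist k A)

/-- The inverse cocycle equation gives (Δ ⊗ id)(J⁻¹) = (J ⊗ 1)(1 ⊗ J⁻¹)(id ⊗ Δ)(J⁻¹). Applying y ⊗ z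
↦ yS(z) to the last two legs removes the final factor by normalization and turns the middle one into
Q⁻¹. -/
theorem comulMulAntipode_inv :
    comulMulAntipode (↑J.J⁻¹ : A ⊗[k] A) = (J.J : A ⊗[k] A) * (1 ⊗ₜ[k] (↑J.Q⁻¹ : A)) := by
  have h : comulLeft (↑J.J⁻¹ : A ⊗[k] A) = tmulOne (J.J : A ⊗[k] A) *
      (oneTmul (↑J.J⁻¹ : A ⊗[k] A) * comulRight (↑J.J⁻¹ : A ⊗[k] A)) := by
    rw [← J.cocycle_inv, ← mul_assoc, J.map_mul_inv, one_mul]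
  change mulAntipode.lTensor A (comulLeft _) = _
  rw [h, lTensor_mulAntipode_tmulOne_mul, lTensor_mulAntipode_oneTmul_mul_comulRight,
    J.counit_right_inv]
  rfl

theorem lTensor_antipodeMul_comulLeft :
    antipodeMul.lTensor A (comulLeft (J.J : A ⊗[k] A)) =
      (antipode k).lTensor A (↑J.J⁻¹ : A ⊗[k] A) * (1 ⊗ₜ[k] (J.Q : A)) := by
  have h : comulLeft (J.J : A ⊗[k] A) = comulRight (J.J : A ⊗[k] A) * oneTmul (J.J : A ⊗[k] A) *
      tmulOne (↑J.J⁻¹ : A ⊗[k] A) := by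
    rw [← J.cocycle, mul_assoc, J.map_mul_inv, mul_one]
  rw [h, lTensor_antipodeMul_comulRight_mul, J.counit_right, ← Algebra.TensorProduct.one_def,
    one_mul]
  rfl

/-- The coproduct of `Q_J`: one has `S(J^{(2)}) ⊗ S(J^{(1)}) · Δ(Q_J) · J = Q_J ⊗ Q_J`. -/
theorem antipodeSwap_mul_comul_Q :
    antipodeSwap (J.J : A ⊗[k] A) * comul (R := k) (J.Q : A) * (J.J : A ⊗[k] A) =
      (J.Q : A) ⊗ₜ[k] (J.Q : A) := by
  -- `antipodeSwapMulComul` is evaluated on the two sides of the cocycle equation; this is the left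
  -- side.
  have h₁ : ∀ X Y : A ⊗[k] A, antipodeSwapMulComul (comulLeft Y * tmulOne X) =
      antipodeSwap X * comul (R := k) (antipodeMul Y) := by
    intro X Y
    induction Y with
    | zero => simp
    | add Y Y' hY hY' => simp only [map_add, add_mul, mul_add, hY, hY']
    | tmul x y =>
      rw [comulLeft_tmul_mul_tmulOne, antipodeSwapMulComul_assoc, antipodeSwap_mul,
        ← comul_antipode, antipodeMul_tmul, comul_mul, mul_assoc]
  -- The trailing J supplies the factor 1 ⊗ J needed to use the cocycle equation a second time.
  have h₂ : ∀ Y : A ⊗[k] A,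
      antipodeSwapMulComul (comulRight Y * oneTmul (J.J : A ⊗[k] A)) * (J.J : A ⊗[k] A) =
        (J.Q : A) ⊗ₜ[k] antipodeMul Y := by
    intro Y
    induction Y with
    | zero => simp
    | add Y Y' hY hY' => simp only [map_add, add_mul, TensorProduct.tmul_add, hY, hY']
    | tmul x y =>
      rw [comulRight_tmul, oneTmul_apply, Algebra.TensorProduct.tmul_mul_tmul, mul_one,
        antipodeSwapMulComul_tmul, mul_assoc, ← antipodeMulLeft_mul_oneTmul, map_mul comulRight,
        mul_assoc,
        ← J.cocycle, ← comulLeft_comul, ← mul_assoc, ← map_mul,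
        antipodeMulLeft_comulLeft_mul_tmulOne, map_mul (applyLeft _), J.counit_left, applyLeft_comul]
      simp
      rfl
  have h := h₁ J.J J.J
  rw [J.cocycle] at h
  exact (congrArg (· * (J.J : A ⊗[k] A)) h).symm.trans (h₂ J.J)

/-- The preceding identity makes the right-hand side a left inverse of Δ(Q), while Δ(Q⁻¹) is a right
inverse. -/
theorem comul_Q_inv :
    comul (R := k) (↑J.Q⁻¹ : A) =
      (J.J : A ⊗[k] A) * ((↑J.Q⁻¹ : A) ⊗ₜ[k] (↑J.Q⁻¹ : A)) * antipodeSwap (J.J : A ⊗[k] A) := by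
  symm
  refine left_inv_eq_right_inv (a := comul (R := k) (J.Q : A)) ?_ ?_
  · have h := congrArg (· * (↑J.J⁻¹ : A ⊗[k] A)) J.antipodeSwap_mul_comul_Q
    simp only [Units.mul_inv_cancel_right] at h
    rw [mul_assoc, h, mul_assoc, ← mul_assoc (_ ⊗ₜ[k] _), Algebra.TensorProduct.tmul_mul_tmul,
      Units.inv_mul, ← Algebra.TensorProduct.one_def, one_mul, Units.mul_inv]
  · rw [← comul_mul, Units.mul_inv, comul_one]

/-- The coproduct of `v = S(Q_J⁻¹) Q_J`: one has `Δ(v) J = (S² ⊗ S²)(J) (v ⊗ v)`. -/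
theorem comul_antipode_Q_inv_mul_Q :
    comul (R := k) (antipode k (↑J.Q⁻¹ : A) * (J.Q : A)) * (J.J : A ⊗[k] A) =
      Algebra.TensorProduct.map (antipodeSq (k := k)) antipodeSq (J.J : A ⊗[k] A) *
        ((antipode k (↑J.Q⁻¹ : A) * (J.Q : A)) ⊗ₜ[k] (antipode k (↑J.Q⁻¹ : A) * (J.Q : A))) := by
  rw [comul_mul, comul_antipode, comul_Q_inv, antipodeSwap_mul, antipodeSwap_mul,
    antipodeSwap_antipodeSwap, antipodeSwap_tmul, ← Algebra.TensorProduct.tmul_mul_tmul,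
    ← J.antipodeSwap_mul_comul_Q]
  simp only [mul_assoc]

/-- The map `x ⊗ y ↦ (1 ⊗ S(y)) Δ(S²(α(x₁) x₂))`. -/
def translateMul (α : A →ₐ[k] k) : A ⊗[k] A →ₗ[k] A ⊗[k] A :=
  TensorProduct.map (antipodeSq.toLinearMap ∘ₗ (translate α).toLinearMap) (antipode k) ∘ₗ
    antipodeMul.lTensor A ∘ₗ comulLeft.toLinearMap

/-- Δ commutes with S² and with the translation on the first leg, and S(y)S²(x₂) = S(S(x₂)y). -/
theorem translateMul_tmul (α : A →ₐ[k] k) (x y : A) :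
    translateMul α (x ⊗ₜ[k] y) = (1 ⊗ₜ[k] antipode k y) *
      comul (R := k) (antipode k (antipode k (translate α x))) := by
  rw [comul_antipodeSq, comul_translate]
  simp only [translateMul, LinearMap.comp_apply, AlgHom.toLinearMap_apply, comulLeft_tmul]
  generalize comul (R := k) x = X
  induction X with
  | zero => simp
  | add X X' hX hX' => simp only [map_add, mul_add, TensorProduct.add_tmul, hX, hX']
  | tmul x z => simp [antipode_mul_antidistrib]

/-- Applying α to the first leg of the inverse cocycle equation gives (R ⊗ 1) · (this tensor) =
J⁻¹Δ(R). -/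
theorem map_translate_inv (α : A →ₐ[k] k) :
    Algebra.TensorProduct.map (translate α) (AlgHom.id k A) (↑J.J⁻¹ : A ⊗[k] A) =
      ((↑(J.R α)⁻¹ : A) ⊗ₜ[k] 1) * (↑J.J⁻¹ : A ⊗[k] A) * comul (R := k) (J.R α : A) := by
  have h := congrArg (applyFirst α) J.cocycle_inv
  rw [map_mul, map_mul, applyFirst_tmulOne, applyFirst_comulLeft, applyFirst_oneTmul,
    applyFirst_comulRight] at h
  change ((J.R α : A) ⊗ₜ[k] 1) * _ = _ * comul (R := k) (J.R α : A) at h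
  rw [mul_assoc, ← h, ← mul_assoc, Algebra.TensorProduct.tmul_mul_tmul, Units.inv_mul, one_mul,
    ← Algebra.TensorProduct.one_def, one_mul]

theorem translateMul_J (α : A →ₐ[k] k) :
    translateMul α (J.J : A ⊗[k] A) = (1 ⊗ₜ[k] antipode k (J.Q : A)) *
      Algebra.TensorProduct.map (antipodeSq (k := k)) antipodeSq
        (((↑(J.R α)⁻¹ : A) ⊗ₜ[k] 1) * (↑J.J⁻¹ : A ⊗[k] A) * comul (R := k) (J.R α : A)) := by
  rw [← map_translate_inv]
  simp only [translateMul, LinearMap.comp_apply, AlgHom.toLinearMap_apply,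
    lTensor_antipodeMul_comulLeft]
  generalize (↑J.J⁻¹ : A ⊗[k] A) = X
  induction X with
  | zero => simp
  | add X X' hX hX' => simp only [map_add, mul_add, add_mul, hX, hX']
  | tmul x z => simp [antipode_mul_antidistrib]

/-- The element `u = S²(R⁻¹) S(Q_J⁻¹) Q_J`. -/
def integralFactor (α : A →ₐ[k] k) : A :=
  antipode k (antipode k (↑(J.R α)⁻¹ : A)) * antipode k (↑J.Q⁻¹ : A) * (J.Q : A)

theorem isUnit_integralFactor (α : A →ₐ[k] k) : IsUnit (J.integralFactor α) := by
  have hS : ∀ u : A, IsUnit u → IsUnit (antipode k u) := by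
    rintro _ ⟨u, rfl⟩
    refine ⟨⟨antipode k (u : A), antipode k (↑u⁻¹ : A), ?_, ?_⟩, rfl⟩
    all_goals rw [← antipode_mul_antidistrib]; simp
  exact ((hS _ (hS _ (Units.isUnit _))).mul (hS _ (Units.isUnit _))).mul (Units.isUnit _)

/-- This fixes the choice of u = S²(R⁻¹)v, v = S(Q⁻¹)Q: the factor S²(R⁻¹) cancels Δ(S²(R)), Δ(v)J =
(S² ⊗ S²)(J)(v ⊗ v) cancels (S² ⊗ S²)(J⁻¹), and S(Q)vQ⁻¹ = 1 clears the second leg. -/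
theorem translateMul_mul_comul_mul (α : A →ₐ[k] k) :
    translateMul α (J.J : A ⊗[k] A) * comul (R := k) (J.integralFactor α) *
      comulMulAntipode (↑J.J⁻¹ : A ⊗[k] A) = J.integralFactor α ⊗ₜ[k] 1 := by
  rw [translateMul_J, comulMulAntipode_inv, integralFactor, mul_assoc (antipode k _), comul_mul,
    map_mul, map_mul, ← comul_antipodeSq]
  have hR : comul (R := k) (antipode k (antipode k (J.R α : A))) *
      comul (R := k) (antipode k (antipode k (↑(J.R α)⁻¹ : A))) = 1 := by
    rw [← comul_mul, ← antipodeSq_apply, ← antipodeSq_apply, ← map_mul, Units.mul_inv, map_one,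
      comul_one]
  set v := antipode k (↑J.Q⁻¹ : A) * (J.Q : A) with hv
  have hQ : antipode k (J.Q : A) * v * (↑J.Q⁻¹ : A) = 1 := by
    rw [hv, ← mul_assoc, ← antipode_mul_antidistrib, Units.inv_mul, antipode_one, one_mul,
      Units.mul_inv]
  calc _ = (1 ⊗ₜ[k] antipode k (J.Q : A)) *
        Algebra.TensorProduct.map (antipodeSq (k := k)) antipodeSq
          ((↑(J.R α)⁻¹ : A) ⊗ₜ[k] 1) *
        Algebra.TensorProduct.map (antipodeSq (k := k)) antipodeSq (↑J.J⁻¹ : A ⊗[k] A) *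
        (comul (R := k) (antipode k (antipode k (J.R α : A))) *
          comul (R := k) (antipode k (antipode k (↑(J.R α)⁻¹ : A)))) *
        (comul (R := k) v * (J.J : A ⊗[k] A)) * (1 ⊗ₜ[k] (↑J.Q⁻¹ : A)) := by
        simp only [mul_assoc]
    _ = (1 ⊗ₜ[k] antipode k (J.Q : A)) *
        Algebra.TensorProduct.map (antipodeSq (k := k)) antipodeSq
          ((↑(J.R α)⁻¹ : A) ⊗ₜ[k] 1) *
        (Algebra.TensorProduct.map (antipodeSq (k := k)) antipodeSq (↑J.J⁻¹ : A ⊗[k] A) *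
        Algebra.TensorProduct.map (antipodeSq (k := k)) antipodeSq (J.J : A ⊗[k] A)) *
        (v ⊗ₜ[k] v) * (1 ⊗ₜ[k] (↑J.Q⁻¹ : A)) := by
        rw [hR, J.comul_antipode_Q_inv_mul_Q]
        simp only [mul_assoc, mul_one, ← hv]
    _ = _ := by
        rw [J.map_inv_mul]
        simp [hQ]

theorem isRightIntegralInDual_twisted_iff (f : Module.Dual k A) :
    IsRightIntegralInDual (f ∘ₗ J.toTwisted.symm.toLinearMap) ↔
      ∀ a : A, contract f ((↑J.J⁻¹ : A ⊗[k] A) * comul (R := k) a * (J.J : A ⊗[k] A)) =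
        f a • (1 : A) := by
  simp only [← twistedComul_apply]
  exact isRightIntegralInDual_iff (A := J.Twisted) (f ∘ₗ J.toTwisted.symm.toLinearMap)

end NormalizedTwist

/-- For X = x ⊗ y and Y = z ⊗ w the Nakayama automorphism turns f(uxa₁z) into f(ba₁) with b =
S²(α(z₁)z₂)ux. The exchange rule then gives S(w)f(b₁a)b₂S(y), and Δ(b) splits into three factors. -/
theorem IsRightIntegralInDual.antipode_contract_mul_comul_mul [FiniteDimensional k A]
    {f : Module.Dual k A} (hf : IsRightIntegralInDual f) (hf0 : f ≠ 0) {α : A →ₐ[k] k}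
    (hα : IsDistinguishedGroupLike α) (X Y : A ⊗[k] A) (u a : A) :
    antipode k (contract (rightAct f u) (X * comul (R := k) a * Y)) =
      contract (f ∘ₗ LinearMap.mulRight k a)
        (NormalizedTwist.translateMul α Y * comul (R := k) u * comulMulAntipode X) := by
  induction X with
  | zero => simp
  | add X X' hX hX' => simp only [map_add, add_mul, mul_add, hX, hX']
  | tmul x y =>
    induction Y with
    | zero => simp
    | add Y Y' hY hY' => simp only [map_add, add_mul, mul_add, hY, hY']
    | tmul z w =>
      have h₁ : ∀ Z : A ⊗[k] A,
          contract (rightAct f u) ((x ⊗ₜ[k] y) * Z * (z ⊗ₜ[k] w)) =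
            y * contract f (((antipode k (antipode k (translate α z)) * u * x) ⊗ₜ[k] 1) * Z) *
              w := by
        intro Z
        induction Z with
        | zero => simp
        | add Z Z' hZ hZ' => simp only [map_add, add_mul, mul_add, hZ, hZ']
        | tmul p q =>
          have := hf.apply_mul hf0 hα z (u * x * p)
          simp only [mul_assoc] at this
          simp [rightAct, mul_assoc, this]
      rw [h₁, antipode_mul_antidistrib, antipode_mul_antidistrib, ← hf.contract_comul_mul,
        contract_mulRight, NormalizedTwist.translateMul_tmul, comulMulAntipode_tmul]
      have h₂ : ∀ (D : A ⊗[k] A), D * (1 ⊗ₜ[k] antipode k y) * (a ⊗ₜ[k] 1) =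
          D * (a ⊗ₜ[k] 1) * (1 ⊗ₜ[k] antipode k y) := by
        intro D
        simp [mul_assoc]
      rw [← mul_assoc _ (comul x), h₂, contract_mul_one_tmul]
      simp only [mul_assoc, comul_mul, contract_one_tmul_mul]

end TwistIdentities

end HopfTwist

end

open HopfTwist in
theorem theorem5p1 {k A : Type*} [Field k] [Ring A] [HopfAlgebra k A] [FiniteDimensional k A]
    (J : NormalizedTwist k A) (lam : Module.Dual k A)
    (hlam : IsRightIntegralInDual lam) (hlam0 : lam ≠ 0) :
    (∃! α : A →ₐ[k] k, IsDistinguishedGroupLike α) ∧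
    ∀ α : A →ₐ[k] k, IsDistinguishedGroupLike α →
      IsRightIntegralInDual (J.twistedFunctional α lam) ∧ J.twistedFunctional α lam ≠ 0 := by
  refine ⟨hlam.existsUnique_isDistinguishedGroupLike hlam0, fun α hα => ⟨?_, fun h => hlam0 ?_⟩⟩
  · change IsRightIntegralInDual
      (rightAct lam (J.integralFactor α) ∘ₗ J.toTwisted.symm.toLinearMap)
    rw [J.isRightIntegralInDual_twisted_iff]
    intro a
    -- After S, the left side is the contraction of u ⊗ 1 with λ(·a), which is λ(ua)1; the right
    -- side is unchanged because S(1) = 1.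
    apply (hlam.antipode_bijective hlam0).1
    rw [hlam.antipode_contract_mul_comul_mul hlam0 hα, J.translateMul_mul_comul_mul]
    simp [rightAct]
  · obtain ⟨u, hu⟩ := J.isUnit_integralFactor α
    refine LinearMap.ext fun a => ?_
    have h' := LinearMap.congr_fun h (J.toTwisted (↑u⁻¹ * a))
    change lam (J.integralFactor α * (↑u⁻¹ * a)) = 0 at h'
    rwa [← hu, Units.mul_inv_cancel_left] at h'
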